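/- Let $G(x)=\tfrac12 e^{-|x|}$, so that $\partial_xG(x)=-\tfrac12\,\mathrm{sgn}(x)e^{-|x|}$, and let $*$ denote convolution on $\mathbb R$. Consider, for real-valued $u,v,w$, the nonlocal form of the three-component Camassa–Holm system $$ \begin{cases} u_t+(u+v+w)u_x+G*(uv_x+uw_x)+\partial_xG*f=0,\\ v_t+(u+v+w)v_x+G*(vu_x+vw_x)+\partial_xG*g=0,\\ w_t+(u+v+w)w_x+G*(wu_x+wv_x)+\partial_xG*h=0,\\ (u,v,w)|_{t=0}=(u_0,v_0,w_0), \end{cases} $$ where $$ \begin{aligned} f&=u^2+\tfrac12u_x^2+u_xv_x+u_xw_x+\tfrac12v^2-\tfrac12v_x^2+\tfrac12w^2-\tfrac12w_x^2,\\ g&=v^2+\tfrac12v_x^2+u_xv_x+w_xv_x+\tfrac12u^2-\tfrac12u_x^2+\tfrac12w^2-\tfrac12w_x^2,\\ h&=w^2+\tfrac12w_x^2+u_xw_x+v_xw_x+\tfrac12u^2-\tfrac12u_x^2+\tfrac12v^2-\tfrac12v_x^2. \end{aligned} $$ **Corollary 3.1.** Let $s>\tfrac32$, $T>0$ and $u_0,v_0,w_0\in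 H^s(\mathbb R)$, and let $(u,v,w)\in C([0,T];H^s\times H^s\times H^s)$ be a solution of this Cauchy problem with initial data $(u_0,v_0,w_0)$: the three equations hold pointwise on $(0,T)\times\mathbb R$ and the initial condition holds at $t=0$. (Elements of $H^s$, $s>\frac32$, are identified with their $C^1$ representatives.) Let $\alpha\in(0,1)$ and suppose that $$ u_0,\ v_0,\ w_0,\ u_{0,x},\ v_{0,x},\ w_{0,x}=O(e^{-\alpha x})\qquad\text{as }x\to+\infty . $$ Then $$ u(t,x),\ v(t,x),\ w(t,x),\ u_x(t,x),\ v_x(t,x),\ w_x(t,x)=O(e^{-\alpha x})\qquad\text{as }x\to+\infty, $$ uniformly for $t\in[0,T]$; that is, there are constants $K>0$ and $X\in\mathbb R$ such that each of these six functions is bounded in absolute value by $Ke^{-\alpha x}$ for all $t\in[0,T]$ and all $x\ge X$. -/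

import Mathlib

open MeasureTheory Set Filter
open scoped SchwartzMap ENNReal

noncomputable section

namespace ThreeCH

/-- `HasBesselPotential s f g`: the real function `f` is square integrable and the Bessel potential
of order `s` of the tempered distribution defined by `f` is the `L²` function `g`. The `H^s` norm
of `f` is then the `L²` norm of `g`. -/
def HasBesselPotential (s : ℝ) (f : ℝ → ℝ) (g : Lp ℂ 2 (volume : Measure ℝ)) : Prop :=
  ∃ hf : MemLp (fun x => (f x : ℂ)) 2 (volume : Measure ℝ),
    TemperedDistribution.besselPotential ℝ ℂ s (hf.toLp _ : 𝓢'(ℝ, ℂ)) = (g : 𝓢'(ℝ, ℂ))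

/-- `f` is the continuous representative of an element of the real Sobolev space `H^s(ℝ)`.
The definition is meant for `s > 1 / 2`, where such a representative always exists; for
`s > 3 / 2` it is continuously differentiable, by the Sobolev embedding. -/
def MemHs (s : ℝ) (f : ℝ → ℝ) : Prop :=
  Continuous f ∧ ∃ g : Lp ℂ 2 (volume : Measure ℝ), HasBesselPotential s f g

/-- `u ∈ C([0,T]; H^s)`: each `u t` is the continuous representative of an element of `H^s`, and
`t ↦ u t` is continuous on `[0,T]` for the `H^s` norm, that is, the Bessel potentials of order `s`
of the `u t` depend continuously on `t` in `L²`. -/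
def ContinuousInHs (s T : ℝ) (u : ℝ → ℝ → ℝ) : Prop :=
  (∀ t ∈ Icc 0 T, Continuous (u t)) ∧
  ∃ U : ℝ → Lp ℂ 2 (volume : Measure ℝ), ContinuousOn U (Icc 0 T) ∧
    ∀ t ∈ Icc 0 T, HasBesselPotential s (u t) (U t)

/-- The Green function `G(x) = e^{-|x|} / 2` of `1 - ∂ₓ²`. -/
def G (x : ℝ) : ℝ := (1 / 2) * Real.exp (-|x|)

/-- The derivative `∂ₓG(x) = -sgn(x) e^{-|x|} / 2` of the Green function. -/
def dG (x : ℝ) : ℝ := -(1 / 2) * Real.sign x * Real.exp (-|x|)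

/-- Convolution of real functions on the line, `(K ∗ F)(x) = ∫ K(y) F(x - y) dy`. -/
def conv (K F : ℝ → ℝ) : ℝ → ℝ :=
  convolution K F (ContinuousLinearMap.mul ℝ ℝ) (volume : Measure ℝ)

/-- The flux `a² + a_x²/2 + a_x b_x + a_x c_x + b²/2 - b_x²/2 + c²/2 - c_x²/2`.
The three fluxes are `f = flux u v w`, `g = flux v u w`, `h = flux w u v`. -/
def flux (a b c : ℝ → ℝ) (x : ℝ) : ℝ :=
  a x ^ 2 + (1 / 2) * deriv a x ^ 2 + deriv a x * deriv b x + deriv a x * deriv c x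
    + (1 / 2) * b x ^ 2 - (1 / 2) * deriv b x ^ 2
    + (1 / 2) * c x ^ 2 - (1 / 2) * deriv c x ^ 2

/-- The time derivative of the component `a` prescribed by the equation
`a_t + (a + b + c) a_x + G ∗ (a b_x + a c_x) + ∂ₓG ∗ flux a b c = 0`. -/
def rhs (a b c : ℝ → ℝ) (x : ℝ) : ℝ :=
  -((a x + b x + c x) * deriv a x
    + conv G (fun y => a y * deriv b y + a y * deriv c y) x
    + conv dG (flux a b c) x)

/-- `(u, v, w) ∈ C([0,T]; H^s × H^s × H^s)` solves the Cauchy problem for the nonlocal form of the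
three-component Camassa--Holm system with initial data `(u₀, v₀, w₀)`. -/
structure IsSolution (s T : ℝ) (u₀ v₀ w₀ : ℝ → ℝ) (u v w : ℝ → ℝ → ℝ) : Prop where
  cont_u : ContinuousInHs s T u
  cont_v : ContinuousInHs s T v
  cont_w : ContinuousInHs s T w
  init_u : u 0 = u₀
  init_v : v 0 = v₀
  init_w : w 0 = w₀
  eq_u : ∀ t ∈ Ioo 0 T, ∀ x, HasDerivAt (fun τ => u τ x) (rhs (u t) (v t) (w t) x) t
  eq_v : ∀ t ∈ Ioo 0 T, ∀ x, HasDerivAt (fun τ => v τ x) (rhs (v t) (u t) (w t) x) t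
  eq_w : ∀ t ∈ Ioo 0 T, ∀ x, HasDerivAt (fun τ => w τ x) (rhs (w t) (u t) (v t) x) t

/-- `f(x) = O(e^{-αx})` as `x → +∞`. -/
def DecaysAtTop (α : ℝ) (f : ℝ → ℝ) : Prop :=
  f =O[atTop] fun x => Real.exp (-α * x)

/-- `F(t,x) = O(e^{-αx})` as `x → +∞`, uniformly for `t ∈ [0,T]`: the constant `K` and the
threshold `X` are the same for all `t`. -/
def DecaysAtTopUniformly (α T : ℝ) (F : ℝ → ℝ → ℝ) : Prop :=
  ∃ K > 0, ∃ X : ℝ, ∀ t ∈ Icc 0 T, ∀ x ≥ X, |F t x| ≤ K * Real.exp (-α * x)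

end ThreeCH

end

/-! Write `S = u + v + w`. Each component solves `a_t + S a_x + P = 0`, where the nonlocal source
`P = G ∗ (a b_x + a c_x) + ∂ₓG ∗ flux` is continuously differentiable in `x` with
`P_x = ∂ₓG ∗ (a b_x + a c_x) + G ∗ flux - flux`, because `∂ₓ²G = G - δ`
(`hasDerivAt_source`). By the Sobolev embedding (`sobolev_embedding`) the components and their space
derivatives are bounded by some `R` and jointly continuous on `[0,T] × ℝ`, which is all that is
used of the spaces `H^s`.

The decay is propagated with the bounded weights `φ(x) = min (e^{αx}) N`. They satisfy
`φ(x) ≤ e^{α|x-y|} φ(y)`, and since `α < 1` this makes convolution with `G` and `∂ₓG` bounded in the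
supremum norm weighted by `φ`, uniformly in `N` (`IsSlowWeight.abs_conv_mul_le`). The products in
`P` and `P_x` are quadratic, so that a weighted bound `B` on the six functions `u, …, w_x` gives a
weighted bound `k B` on `P` and `P_x`, with `k` depending on `R` and `α` only
(`IsSlowWeight.abs_source_mul_le`).

The equation is integrated along the characteristics `q' = S(t, q)`, which move points by at most
a bounded distance. For `a` itself this is immediate. The function `a` need not have second
derivatives in `x`, so `a_x` is not differentiated along a characteristic; instead `a` is compared
on two neighbouring characteristics. Their distance changes by at most a bounded factor, because
`S_x` is bounded, so the difference of `P` on them is controlled by `P_x`, and a local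
Lipschitz bound on `a(t, ·)` results, which is a bound on `a_x`
(`IsC1Path.weighted_bound_of_transport`).

The Grönwall argument is run in the form of a contraction: with bounds of the form `B e^{Λt}` and
`Λ` large, any admissible constant `B` can be replaced by `D M + B / 2`, where `M` bounds the
weighted initial data (`WeightedBound.improve`). As the weight is bounded, some `B` is admissible;
iterating gives the constant `2 D M`, independent of `N`, and `N → ∞` gives the claim. -/

open scoped FourierTransform Topology

namespace ThreeCH

/-! ### The Sobolev embedding for `s > 3 / 2` -/

open TemperedDistribution in
/-- On the Fourier side, the Bessel potential `g` determines `f` by division by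
`(1 + |ξ|²) ^ (s / 2)`. -/
theorem HasBesselPotential.fourier_eq_smul {s : ℝ} {f : ℝ → ℝ} {g : Lp ℂ 2 (volume : Measure ℝ)}
    (h : HasBesselPotential s f g) (hf : MemLp (fun x => (f x : ℂ)) 2 (volume : Measure ℝ)) :
    𝓕 (hf.toLp _ : 𝓢'(ℝ, ℂ)) =
      smulLeftCLM ℂ (fun x : ℝ => (((1 + ‖x‖ ^ 2) ^ (-s / 2) : ℝ) : ℂ))
        ((𝓕 g : Lp ℂ 2 (volume : Measure ℝ)) : 𝓢'(ℝ, ℂ)) := by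
  obtain ⟨_, hfg⟩ := h
  rw [← Lp.fourier_toTemperedDistribution_eq, ← hfg,
    fourier_besselPotential_eq_smulLeftCLM_fourier_apply,
    smulLeftCLM_smulLeftCLM_apply (by fun_prop) (by fun_prop)]
  convert! (smulLeftCLM_const 1 (𝓕 (hf.toLp _ : 𝓢'(ℝ, ℂ)))).symm using 1
  · simp
  · congr
    ext x
    rw [Pi.mul_apply]
    norm_cast
    rw [← Real.rpow_add (by positivity)]
    ring_nf
    simp

theorem memLp_two_rpow_one_add_sq {r : ℝ} (hr : 1 / 2 < r) :
    MemLp (fun x : ℝ => (((1 + ‖x‖ ^ 2) ^ (-r / 2) : ℝ) : ℂ)) 2 (volume : Measure ℝ) := by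
  have : MemLp (fun x : ℝ => ((1 + ‖x‖ ^ 2) ^ (-r / 2) : ℝ)) 2 (volume : Measure ℝ) := by
    rw [memLp_two_iff_integrable_sq]
    · refine (integrable_rpow_neg_one_add_norm_sq (E := ℝ) (r := 2 * r) (by simp; linarith)).congr
        (ae_of_all _ fun x => ?_)
      simp only
      rw [← Real.rpow_mul_natCast (by positivity)]
      congr 1
      push_cast
      ring
    · have : Continuous (fun x : ℝ => ((1 + ‖x‖ ^ 2) ^ (-r / 2) : ℝ)) := by
        refine Continuous.rpow_const (by fun_prop) fun x => Or.inl (by positivity)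
      exact this.aestronglyMeasurable
  exact this.ofReal

/-- If the distributional Fourier transform of a continuous `L²` function is an integrable
function, then the inversion formula holds at every point. The two sides are compared by testing
against Schwartz functions, which makes them equal almost everywhere, and both are continuous. -/
theorem eq_fourierInv_of_fourier_eq {f : ℝ → ℝ} (hcont : Continuous f)
    (hf : MemLp (fun x => (f x : ℂ)) 2 (volume : Measure ℝ)) {φ : ℝ → ℂ} (hφ : Integrable φ)
    (h : ∀ ψ : 𝓢(ℝ, ℂ), 𝓕 (hf.toLp _ : 𝓢'(ℝ, ℂ)) ψ = ∫ ξ, ψ ξ • φ ξ) (x : ℝ) :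
    (f x : ℂ) = 𝓕⁻ φ x := by
  have hL : Continuous fun p : ℝ × ℝ => (-innerₗ ℝ : ℝ →ₗ[ℝ] ℝ →ₗ[ℝ] ℝ) p.1 p.2 := by
    simp only [LinearMap.neg_apply, innerₗ_apply_apply]
    fun_prop
  have hcφ : Continuous (𝓕⁻ φ) :=
    VectorFourier.fourierIntegral_continuous Real.continuous_fourierChar hL hφ
  have key : ∀ ψ : 𝓢(ℝ, ℂ), ∫ y, ψ y • (f y : ℂ) = ∫ y, ψ y • 𝓕⁻ φ y := by
    intro ψ
    have h1 := h (𝓕⁻ ψ)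
    rw [TemperedDistribution.fourier_apply, FourierTransform.fourier_fourierInv_eq,
      Lp.toTemperedDistribution_apply] at h1
    have h2 : ∫ y, ψ y • (hf.toLp _ : Lp ℂ 2 (volume : Measure ℝ)) y = ∫ y, ψ y • (f y : ℂ) := by
      refine integral_congr_ae ?_
      filter_upwards [hf.coeFn_toLp] with y hy
      rw [hy]
    rw [← h2, h1, SchwartzMap.fourierInv_coe]
    have := VectorFourier.integral_fourierIntegral_smul_eq_flip (L := -innerₗ ℝ)
      Real.continuous_fourierChar hL
      (ψ.integrable (μ := volume)) hφ
    have hflip : (-innerₗ ℝ : ℝ →ₗ[ℝ] ℝ →ₗ[ℝ] ℝ).flip = -innerₗ ℝ := by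
      ext; simp
    rw [hflip] at this
    exact this
  have hae : ∀ᵐ y, (f y : ℂ) = 𝓕⁻ φ y := by
    refine ae_eq_of_integral_contDiff_smul_eq (hf.locallyIntegrable (by norm_num))
      hcφ.locallyIntegrable fun ψ hψ hψc => ?_
    have h1 : HasCompactSupport (Complex.ofRealCLM ∘ ψ) := hψc.comp_left rfl
    have h2 : ContDiff ℝ ((⊤ : ℕ∞) : WithTop ℕ∞) (Complex.ofRealCLM ∘ ψ) := by fun_prop
    simpa using key (h1.toSchwartzMap h2)
  have := Continuous.ae_eq_iff_eq volume (Complex.continuous_ofReal.comp hcont) hcφ |>.1 hae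
  exact congrFun this x

theorem norm_fourierInv_le (φ : ℝ → ℂ) (x : ℝ) : ‖𝓕⁻ φ x‖ ≤ ∫ ξ, ‖φ ξ‖ :=
  VectorFourier.norm_fourierIntegral_le_integral_norm _ _ _ _ _

/-- The Cauchy–Schwarz inequality on `L²`, for a function and an element of `Lp`. -/
theorem integrable_mul_and_integral_norm_le {m : ℝ → ℂ} (hm : MemLp m 2 (volume : Measure ℝ))
    (g : Lp ℂ 2 (volume : Measure ℝ)) :
    Integrable (fun ξ => m ξ * g ξ) ∧ ∫ ξ, ‖m ξ * g ξ‖ ≤ ‖hm.toLp m‖ * ‖g‖ := by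
  have hae : ((hm.toLp m • g : Lp ℂ 1 (volume : Measure ℝ)) : ℝ → ℂ) =ᵐ[volume]
      fun ξ => m ξ * g ξ := by
    filter_upwards [Lp.coeFn_lpSMul (r := 1) (hm.toLp m) g, hm.coeFn_toLp] with ξ h1 h2
    simp [h1, h2]
  refine ⟨(L1.integrable_coeFn _).congr hae, ?_⟩
  calc ∫ ξ, ‖m ξ * g ξ‖ = ‖(hm.toLp m • g : Lp ℂ 1 (volume : Measure ℝ))‖ := by
        rw [L1.norm_eq_integral_norm]
        refine integral_congr_ae ?_
        filter_upwards [hae] with ξ h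
        rw [h]
    _ ≤ _ := Lp.norm_smul_le _ _

/-- The embedding of `H^s(ℝ)` into the bounded `C¹` functions with bounded derivative, for
`s > 3 / 2`: `ξ ↦ (1 + |ξ|) |f̂(ξ)|` is integrable, so Fourier inversion can be differentiated under
the integral. -/
theorem sobolev_embedding {s : ℝ} (hs : 3 / 2 < s) :
    ∃ C, 0 ≤ C ∧ ∀ (f : ℝ → ℝ) (g : Lp ℂ 2 (volume : Measure ℝ)), Continuous f →
      HasBesselPotential s f g → Differentiable ℝ f ∧ Continuous (deriv f) ∧
        (∀ x, |f x| ≤ C * ‖g‖) ∧ ∀ x, |deriv f x| ≤ C * ‖g‖ := by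
  -- `m` dominates both the multiplier `n` of order `-s` and `|ξ| n`, and it is square integrable
  -- because `s - 1 > 1 / 2`.
  have hm := memLp_two_rpow_one_add_sq (r := s - 1) (by linarith)
  set m : ℝ → ℂ := fun x : ℝ => (((1 + ‖x‖ ^ 2) ^ (-(s - 1) / 2) : ℝ) : ℂ) with hmdef
  refine ⟨2 * Real.pi * ‖hm.toLp m‖, by positivity, fun f g hcont hfg => ?_⟩
  obtain ⟨hint, hle⟩ := integrable_mul_and_integral_norm_le hm (𝓕 g)
  rw [Lp.norm_fourier_eq] at hle
  set ghat : ℝ → ℂ := ⇑(𝓕 g : Lp ℂ 2 (volume : Measure ℝ)) with hghat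
  set n : ℝ → ℂ := fun x : ℝ => (((1 + ‖x‖ ^ 2) ^ (-s / 2) : ℝ) : ℂ) with hndef
  have hn_eq : ∀ ξ : ℝ, ‖n ξ‖ * (1 + ‖ξ‖ ^ 2) ^ (1 / 2 : ℝ) = ‖m ξ‖ := by
    intro ξ
    simp only [hndef, hmdef, Complex.norm_real]
    rw [Real.norm_of_nonneg (Real.rpow_nonneg (by positivity) _),
      Real.norm_of_nonneg (Real.rpow_nonneg (by positivity) _), ← Real.rpow_add (by positivity)]
    congr 1
    ring
  have hn1 : ∀ ξ : ℝ, ‖n ξ‖ ≤ ‖m ξ‖ := by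
    intro ξ
    rw [← hn_eq]
    refine le_mul_of_one_le_right (norm_nonneg _)
      (Real.one_le_rpow (by simp [sq_nonneg]) (by norm_num))
  have hn2 : ∀ ξ : ℝ, ‖ξ‖ * ‖n ξ‖ ≤ ‖m ξ‖ := by
    intro ξ
    rw [← hn_eq, mul_comm]
    refine mul_le_mul_of_nonneg_left ?_ (norm_nonneg _)
    rw [← Real.sqrt_eq_rpow]
    refine Real.le_sqrt_of_sq_le (by linarith)
  set φ : ℝ → ℂ := fun ξ => n ξ * ghat ξ with hφdef
  have hncont : Continuous n := by
    refine Complex.continuous_ofReal.comp (Continuous.rpow_const (by fun_prop)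
      fun x => Or.inl (by positivity))
  have hφm : AEStronglyMeasurable φ volume :=
    hncont.aestronglyMeasurable.mul (Lp.aestronglyMeasurable _)
  have hφ1 : ∀ ξ, ‖φ ξ‖ ≤ ‖m ξ * ghat ξ‖ := by
    intro ξ
    rw [norm_mul, norm_mul]
    exact mul_le_mul_of_nonneg_right (hn1 ξ) (norm_nonneg _)
  have hφ2 : ∀ ξ, ‖ξ‖ * ‖φ ξ‖ ≤ ‖m ξ * ghat ξ‖ := by
    intro ξ
    rw [norm_mul, norm_mul, ← mul_assoc]
    exact mul_le_mul_of_nonneg_right (hn2 ξ) (norm_nonneg _)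
  have hφint : Integrable φ := hint.mono hφm (ae_of_all _ hφ1)
  have hφint' : Integrable (fun ξ : ℝ => ξ • φ ξ) := by
    refine hint.mono (continuous_id.aestronglyMeasurable.smul hφm) (ae_of_all _ fun ξ => ?_)
    rw [norm_smul]
    exact hφ2 ξ
  have hf : MemLp (fun x => (f x : ℂ)) 2 (volume : Measure ℝ) := hfg.1
  have hrep : ∀ x, (f x : ℂ) = 𝓕⁻ φ x := by
    refine eq_fourierInv_of_fourier_eq hcont hf hφint fun ψ => ?_
    rw [hfg.fourier_eq_smul hf, TemperedDistribution.smulLeftCLM_apply_apply,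
      Lp.toTemperedDistribution_apply]
    congr 1
    ext ξ
    rw [SchwartzMap.smulLeftCLM_apply_apply (by fun_prop)]
    simp only [hφdef, hndef, smul_eq_mul, hghat]
    ring
  set χ : ℝ → ℂ := fun x : ℝ => (-2 * Real.pi * Complex.I * x) • φ x with hχdef
  have hχint : Integrable χ := by
    refine (hφint'.const_mul (-2 * Real.pi * Complex.I)).congr (ae_of_all _ fun ξ => ?_)
    simp only [hχdef, Complex.real_smul, smul_eq_mul]
    ring
  have hχcont : Continuous (𝓕 χ) :=
    VectorFourier.fourierIntegral_continuous Real.continuous_fourierChar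
      (L := innerₗ ℝ) (continuous_inner (𝕜 := ℝ) (E := ℝ)) hχint
  have hχnorm : ∀ y, ‖𝓕 χ y‖ ≤ 2 * Real.pi * ‖hm.toLp m‖ * ‖g‖ := by
    intro y
    calc ‖𝓕 χ y‖ ≤ ∫ ξ, ‖χ ξ‖ := VectorFourier.norm_fourierIntegral_le_integral_norm _ _ _ _ _
      _ ≤ ∫ ξ, 2 * Real.pi * ‖m ξ * ghat ξ‖ := by
        refine integral_mono hχint.norm (hint.norm.const_mul _) fun ξ => ?_
        have : ‖χ ξ‖ = 2 * Real.pi * (‖ξ‖ * ‖φ ξ‖) := by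
          simp [hχdef, abs_of_pos Real.pi_pos, mul_assoc]
        simp only [this]
        exact mul_le_mul_of_nonneg_left (hφ2 ξ) (by positivity)
      _ ≤ 2 * Real.pi * ‖hm.toLp m‖ * ‖g‖ := by
        rw [integral_const_mul, mul_assoc (2 * Real.pi) ‖hm.toLp m‖]
        exact mul_le_mul_of_nonneg_left hle (by positivity)
  have hderivC : ∀ x, HasDerivAt (fun x => (f x : ℂ)) (-𝓕 χ (-x)) x := by
    intro x
    have h1 := (Real.hasDerivAt_fourier hφint hφint' (-x)).scomp x (hasDerivAt_neg x)
    have h2 : (fun x => (f x : ℂ)) = 𝓕 φ ∘ Neg.neg := by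
      ext y
      rw [hrep, Real.fourierInv_eq_fourier_neg]
      rfl
    rw [h2]
    simpa only [neg_smul, one_smul] using h1
  have hderiv : ∀ x, HasDerivAt f (-𝓕 χ (-x)).re x := fun x => by
    simpa using! Complex.reCLM.hasFDerivAt.comp_hasDerivAt x (hderivC x)
  have hdf : deriv f = fun x => (-𝓕 χ (-x)).re := funext fun x => (hderiv x).deriv
  refine ⟨fun x => (hderiv x).differentiableAt, ?_, fun x => ?_, fun x => ?_⟩
  · rw [hdf]
    exact Complex.continuous_re.comp (hχcont.comp continuous_neg).neg
  · have h1 : |f x| = ‖(f x : ℂ)‖ := by simp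
    rw [h1, hrep]
    calc ‖𝓕⁻ φ x‖ ≤ ∫ ξ, ‖φ ξ‖ := norm_fourierInv_le φ x
      _ ≤ ∫ ξ, ‖m ξ * ghat ξ‖ := integral_mono hφint.norm hint.norm hφ1
      _ ≤ ‖hm.toLp m‖ * ‖g‖ := hle
      _ ≤ 2 * Real.pi * (‖hm.toLp m‖ * ‖g‖) :=
        le_mul_of_one_le_left (by positivity) (by nlinarith [Real.pi_gt_three])
      _ = _ := by ring
  · rw [hdf]
    refine (Complex.abs_re_le_norm _).trans ?_
    rw [norm_neg]
    exact hχnorm _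

theorem HasBesselPotential.sub {s : ℝ} {f₁ f₂ : ℝ → ℝ} {g₁ g₂ : Lp ℂ 2 (volume : Measure ℝ)}
    (h₁ : HasBesselPotential s f₁ g₁) (h₂ : HasBesselPotential s f₂ g₂) :
    HasBesselPotential s (fun x => f₁ x - f₂ x) (g₁ - g₂) := by
  obtain ⟨hf₁, e₁⟩ := h₁
  obtain ⟨hf₂, e₂⟩ := h₂
  have hf : MemLp (fun x => ((f₁ x - f₂ x : ℝ) : ℂ)) 2 (volume : Measure ℝ) := by
    simpa using! hf₁.sub hf₂
  refine ⟨hf, ?_⟩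
  have h : hf.toLp _ = hf₁.toLp _ - hf₂.toLp _ := by
    rw [← MemLp.toLp_sub]
    congr 1
    ext x
    simp
  rw [h, ← Lp.toTemperedDistributionCLM_apply, ← Lp.toTemperedDistributionCLM_apply, map_sub,
    map_sub, map_sub, Lp.toTemperedDistributionCLM_apply, Lp.toTemperedDistributionCLM_apply,
    Lp.toTemperedDistributionCLM_apply, Lp.toTemperedDistributionCLM_apply, e₁, e₂]

/-- A path of `C¹` functions on the line, parametrised by `[0,T]`: the functions and their space
derivatives are jointly continuous and bounded by a common constant. -/
structure IsC1Path (T : ℝ) (a : ℝ → ℝ → ℝ) : Prop where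
  differentiable : ∀ t ∈ Icc 0 T, Differentiable ℝ (a t)
  continuousOn : ContinuousOn (fun p : ℝ × ℝ => a p.1 p.2) (Icc 0 T ×ˢ univ)
  continuousOn_deriv : ContinuousOn (fun p : ℝ × ℝ => deriv (a p.1) p.2) (Icc 0 T ×ˢ univ)
  bounded : ∃ R, 0 ≤ R ∧ ∀ t ∈ Icc 0 T, ∀ x, |a t x| ≤ R ∧ |deriv (a t) x| ≤ R

/-- A family of continuous functions is jointly continuous if it depends continuously on the
parameter, uniformly in the space variable. -/
theorem continuousOn_of_dist_le {T C : ℝ} {E : Type*} [SeminormedAddCommGroup E]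
    {U : ℝ → E} (hU : ContinuousOn U (Icc 0 T)) {F : ℝ → ℝ → ℝ}
    (hF : ∀ t ∈ Icc 0 T, Continuous (F t))
    (hd : ∀ t ∈ Icc 0 T, ∀ t' ∈ Icc 0 T, ∀ x, |F t x - F t' x| ≤ C * ‖U t - U t'‖) :
    ContinuousOn (fun p : ℝ × ℝ => F p.1 p.2) (Icc 0 T ×ˢ univ) := by
  rintro ⟨t₀, x₀⟩ ⟨ht₀, -⟩
  have ht₀ : t₀ ∈ Icc 0 T := ht₀
  rw [ContinuousWithinAt, tendsto_iff_dist_tendsto_zero]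
  have h1 : Tendsto (fun p : ℝ × ℝ => C * ‖U p.1 - U t₀‖ + |F t₀ p.2 - F t₀ x₀|)
      (𝓝[Icc 0 T ×ˢ univ] (t₀, x₀)) (𝓝 (C * ‖U t₀ - U t₀‖ + |F t₀ x₀ - F t₀ x₀|)) := by
    refine Tendsto.add (Tendsto.const_mul _ (Tendsto.norm (Tendsto.sub_const ?_ _))) ?_
    · refine (hU t₀ ht₀).tendsto.comp ?_
      rw [nhdsWithin_prod_eq]
      exact tendsto_fst
    · have : Continuous fun p : ℝ × ℝ => |F t₀ p.2 - F t₀ x₀| := by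
        have := hF t₀ ht₀
        fun_prop
      exact this.continuousWithinAt
  have h0 : C * ‖U t₀ - U t₀‖ + |F t₀ x₀ - F t₀ x₀| = 0 := by simp
  rw [h0] at h1
  refine squeeze_zero' (Eventually.of_forall fun _ => dist_nonneg) ?_ h1
  filter_upwards [self_mem_nhdsWithin] with p hp
  rw [Real.dist_eq]
  calc |F p.1 p.2 - F t₀ x₀| ≤ |F p.1 p.2 - F t₀ p.2| + |F t₀ p.2 - F t₀ x₀| := abs_sub_le _ _ _
    _ ≤ _ := by gcongr; exact hd _ hp.1 _ ht₀ _

/-- Only this consequence of `u ∈ C([0,T]; H^s)` enters the decay estimates. -/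
theorem ContinuousInHs.isC1Path {s T : ℝ} (hs : 3 / 2 < s) {a : ℝ → ℝ → ℝ}
    (ha : ContinuousInHs s T a) : IsC1Path T a := by
  obtain ⟨C, hC, hemb⟩ := sobolev_embedding hs
  obtain ⟨hcont, U, hU, hB⟩ := ha
  have h t (ht : t ∈ Icc 0 T) := hemb (a t) (U t) (hcont t ht) (hB t ht)
  have hsub t (ht : t ∈ Icc 0 T) t' (ht' : t' ∈ Icc 0 T) :=
    hemb _ _ ((hcont t ht).sub (hcont t' ht')) ((hB t ht).sub (hB t' ht'))
  refine ⟨fun t ht => (h t ht).1, ?_, ?_, ?_⟩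
  · exact continuousOn_of_dist_le (C := C) hU hcont
      fun t ht t' ht' => (hsub t ht t' ht').2.2.1
  · refine continuousOn_of_dist_le (C := C) hU (fun t ht => (h t ht).2.1)
      fun t ht t' ht' x => ?_
    have h1 := (hsub t ht t' ht').2.2.2 x
    rwa [deriv_sub ((h t ht).1 x) ((h t' ht').1 x)] at h1
  · obtain ⟨M, hM⟩ := isCompact_Icc.exists_bound_of_continuousOn hU
    refine ⟨C * max M 0, by positivity, fun t ht x => ?_⟩
    have hle : C * ‖U t‖ ≤ C * max M 0 :=
      mul_le_mul_of_nonneg_left ((hM t ht).trans (le_max_left _ _)) hC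
    exact ⟨((h t ht).2.2.1 x).trans hle, ((h t ht).2.2.2 x).trans hle⟩

/-! ### Convolution with the Green function -/

theorem hasDerivAt_integral_Iic {h : ℝ → ℝ} (hc : Continuous h)
    (hi : ∀ x, IntegrableOn h (Iic x)) (x : ℝ) :
    HasDerivAt (fun x => ∫ y in Iic x, h y) (h x) x := by
  have h1 : (fun x => ∫ y in Iic x, h y) =
      fun x => (∫ y in Iic 0, h y) + ∫ y in (0 : ℝ)..x, h y := by
    ext x
    rw [← intervalIntegral.integral_Iic_sub_Iic (hi 0) (hi x)]
    ring
  rw [h1]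
  exact (intervalIntegral.integral_hasDerivAt_right (hc.intervalIntegrable _ _)
    hc.stronglyMeasurable.stronglyMeasurableAtFilter hc.continuousAt).const_add _

theorem hasDerivAt_integral_Ioi {h : ℝ → ℝ} (hc : Continuous h)
    (hi : ∀ x, IntegrableOn h (Ioi x)) (x : ℝ) :
    HasDerivAt (fun x => ∫ y in Ioi x, h y) (-h x) x := by
  have h1 : (fun x => ∫ y in Ioi x, h y) =
      fun x => (∫ y in Ioi 0, h y) - ∫ y in (0 : ℝ)..x, h y := by
    ext x
    rw [← intervalIntegral.integral_Ioi_sub_Ioi' (hi 0) (hi x)]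
    ring
  rw [h1]
  exact (intervalIntegral.integral_hasDerivAt_right (hc.intervalIntegrable _ _)
    hc.stronglyMeasurable.stronglyMeasurableAtFilter hc.continuousAt).const_sub _

section Kernel

variable {F : ℝ → ℝ} {R : ℝ}

theorem integrableOn_exp_mul_Iic_of_bounded (hF : Continuous F) (hR : ∀ x, |F x| ≤ R) (x : ℝ) :
    IntegrableOn (fun y => Real.exp y * F y) (Iic x) :=
  (integrableOn_exp_Iic x).mul_bdd (c := R) hF.aestronglyMeasurable (ae_of_all _ hR)

theorem integrableOn_exp_neg_mul_Ioi_of_bounded (hF : Continuous F) (hR : ∀ x, |F x| ≤ R)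
    (x : ℝ) : IntegrableOn (fun y => Real.exp (-y) * F y) (Ioi x) :=
  (integrableOn_exp_neg_Ioi x).mul_bdd (c := R) hF.aestronglyMeasurable (ae_of_all _ hR)

/-- Convolution with a kernel equal to `p e^{-z}` for `z > 0` and to `q e^z` for `z < 0`. The value
of the kernel at `0` plays no role, in particular the choice `sgn 0 = 0` in `dG`. -/
theorem conv_eq_of_eq_exp (hF : Continuous F) (hR : ∀ x, |F x| ≤ R) {K : ℝ → ℝ} {p q : ℝ}
    (hpos : ∀ z > 0, K z = p * Real.exp (-z)) (hneg : ∀ z < 0, K z = q * Real.exp z) (x : ℝ) :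
    conv K F x = p * Real.exp (-x) * (∫ y in Iic x, Real.exp y * F y) +
      q * Real.exp x * ∫ y in Ioi x, Real.exp (-y) * F y := by
  have e1 : ∀ y < x, K (x - y) * F y = p * Real.exp (-x) * (Real.exp y * F y) := by
    intro y hy
    rw [hpos _ (sub_pos.2 hy), neg_sub, sub_eq_add_neg, Real.exp_add]
    ring
  have e2 : ∀ y > x, K (x - y) * F y = q * Real.exp x * (Real.exp (-y) * F y) := by
    intro y hy
    rw [hneg _ (sub_neg.2 hy), sub_eq_add_neg, Real.exp_add]
    ring
  have i1 : IntegrableOn (fun y => K (x - y) * F y) (Iic x) := by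
    rw [integrableOn_Iic_iff_integrableOn_Iio]
    refine IntegrableOn.congr_fun (((integrableOn_exp_mul_Iic_of_bounded hF hR x).mono_set
      Iio_subset_Iic_self).const_mul (p * Real.exp (-x))) (fun y hy => (e1 y hy).symm)
      measurableSet_Iio
  have i2 : IntegrableOn (fun y => K (x - y) * F y) (Ioi x) :=
    IntegrableOn.congr_fun ((integrableOn_exp_neg_mul_Ioi_of_bounded hF hR x).const_mul
      (q * Real.exp x)) (fun y hy => (e2 y hy).symm) measurableSet_Ioi
  rw [conv, convolution_mul_swap, ← intervalIntegral.integral_Iic_add_Ioi i1 i2,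
    ← integral_const_mul, ← integral_const_mul, setIntegral_congr_fun measurableSet_Ioi e2,
    integral_Iic_eq_integral_Iio, integral_Iic_eq_integral_Iio,
    setIntegral_congr_fun measurableSet_Iio e1]

/-- The jump `p - q` of the kernel at `0` contributes a local term to the derivative of the
convolution. -/
theorem hasDerivAt_conv_of_eq_exp (hF : Continuous F) (hR : ∀ x, |F x| ≤ R) {K K' : ℝ → ℝ}
    {p q : ℝ} (hpos : ∀ z > 0, K z = p * Real.exp (-z)) (hneg : ∀ z < 0, K z = q * Real.exp z)
    (hpos' : ∀ z > 0, K' z = -p * Real.exp (-z)) (hneg' : ∀ z < 0, K' z = q * Real.exp z)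
    (x : ℝ) : HasDerivAt (conv K F) (conv K' F x + (p - q) * F x) x := by
  have hA := hasDerivAt_integral_Iic (h := fun y => Real.exp y * F y) (by fun_prop)
    (integrableOn_exp_mul_Iic_of_bounded hF hR) x
  have hB := hasDerivAt_integral_Ioi (h := fun y => Real.exp (-y) * F y) (by fun_prop)
    (integrableOn_exp_neg_mul_Ioi_of_bounded hF hR) x
  have hn : HasDerivAt (fun x : ℝ => Real.exp (-x)) (-Real.exp (-x)) x := by
    simpa using (hasDerivAt_neg x).exp
  have := ((hn.const_mul p).mul hA).add (((Real.hasDerivAt_exp x).const_mul q).mul hB)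
  rw [conv_eq_of_eq_exp hF hR hpos' hneg',
    show conv K F = _ from funext (conv_eq_of_eq_exp hF hR hpos hneg)]
  refine this.congr_deriv ?_
  have hx : Real.exp (-x) * Real.exp x = 1 := by rw [← Real.exp_add]; simp
  linear_combination (p - q) * F x * hx

theorem G_of_pos {z : ℝ} (hz : 0 < z) : G z = 1 / 2 * Real.exp (-z) := by
  rw [G, abs_of_pos hz]

theorem G_of_neg {z : ℝ} (hz : z < 0) : G z = 1 / 2 * Real.exp z := by
  rw [G, abs_of_neg hz, neg_neg]

theorem dG_of_pos {z : ℝ} (hz : 0 < z) : dG z = -(1 / 2) * Real.exp (-z) := by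
  rw [dG, abs_of_pos hz, Real.sign_of_pos hz, mul_one]

theorem dG_of_neg {z : ℝ} (hz : z < 0) : dG z = 1 / 2 * Real.exp z := by
  rw [dG, abs_of_neg hz, Real.sign_of_neg hz, neg_neg]
  ring

theorem hasDerivAt_conv_G (hF : Continuous F) (hR : ∀ x, |F x| ≤ R) (x : ℝ) :
    HasDerivAt (conv G F) (conv dG F x) x := by
  simpa using hasDerivAt_conv_of_eq_exp hF hR (fun z => G_of_pos) (fun z => G_of_neg)
    (fun z => dG_of_pos) (fun z => dG_of_neg) x

theorem hasDerivAt_conv_dG (hF : Continuous F) (hR : ∀ x, |F x| ≤ R) (x : ℝ) :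
    HasDerivAt (conv dG F) (conv G F x - F x) x := by
  have := hasDerivAt_conv_of_eq_exp hF hR (K' := G) (fun z => dG_of_pos) (fun z => dG_of_neg)
    (fun z hz => by rw [G_of_pos hz]; ring) (fun z => G_of_neg) x
  exact this.congr_deriv (by ring)

theorem abs_G_le (z : ℝ) : |G z| ≤ 1 / 2 * Real.exp (-|z|) := by
  rw [G, abs_of_nonneg (by positivity)]

theorem abs_dG_le (z : ℝ) : |dG z| ≤ 1 / 2 * Real.exp (-|z|) := by
  have : |Real.sign z| ≤ 1 := by
    rcases Real.sign_apply_eq z with h | h | h <;> simp [h]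
  rw [dG, abs_mul, abs_mul, abs_neg, Real.abs_exp, abs_of_nonneg (by norm_num : (0 : ℝ) ≤ 1 / 2)]
  exact mul_le_mul_of_nonneg_right (by linarith) (Real.exp_pos _).le

end Kernel

/-- A positive weight on the line that grows and decays at most like `e^{α|x|}`, in the sense that
`φ x ≤ e^{α|x-y|} φ y` for all `x` and `y`. -/
structure IsSlowWeight (α : ℝ) (φ : ℝ → ℝ) : Prop where
  pos : ∀ x, 0 < φ x
  le_mul : ∀ x y, φ x ≤ Real.exp (α * |x - y|) * φ y

theorem isSlowWeight_min_exp {α N : ℝ} (hα : 0 ≤ α) (hN : 0 < N) :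
    IsSlowWeight α fun x => min (Real.exp (α * x)) N := by
  refine ⟨fun x => lt_min (Real.exp_pos _) hN, fun x y => ?_⟩
  have h1 : 1 ≤ Real.exp (α * |x - y|) := Real.one_le_exp (by positivity)
  rw [mul_min_of_nonneg _ _ (Real.exp_pos _).le]
  refine min_le_min ?_ (le_mul_of_one_le_left hN.le h1)
  rw [← Real.exp_add, Real.exp_le_exp, ← mul_add]
  exact mul_le_mul_of_nonneg_left (by linarith [le_abs_self (x - y)]) hα

theorem integrable_exp_neg_mul_abs {c : ℝ} (hc : 0 < c) :
    Integrable fun z : ℝ => Real.exp (-(c * |z|)) := by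
  have h1 : IntegrableOn (fun z : ℝ => Real.exp (-(c * |z|))) (Ioi 0) :=
    (integrableOn_exp_mul_Ioi (neg_lt_zero.2 hc) 0).congr_fun
      (fun z hz => by simp only [abs_of_pos (mem_Ioi.1 hz), neg_mul]) measurableSet_Ioi
  have h2 : IntegrableOn (fun z : ℝ => Real.exp (-(c * |z|))) (Iic 0) :=
    (integrableOn_exp_mul_Iic hc 0).congr_fun
      (fun z hz => by simp only [abs_of_nonpos (mem_Iic.1 hz), mul_neg, neg_neg]) measurableSet_Iic
  rw [← integrableOn_univ, ← Iic_union_Ioi (a := (0 : ℝ))]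
  exact h2.union h1

/-- Convolution with a kernel bounded by `e^{-|z|} / 2` is bounded in the supremum norm weighted by
a slow weight of rate `α < 1`, with a constant that depends on `α` only. -/
theorem IsSlowWeight.abs_conv_mul_le {α B : ℝ} {φ K F : ℝ → ℝ} (hα : α < 1)
    (hφ : IsSlowWeight α φ) (hK : ∀ z, |K z| ≤ 1 / 2 * Real.exp (-|z|))
    (hB : ∀ y, |F y| * φ y ≤ B) (x : ℝ) :
    |conv K F x| * φ x ≤ (∫ z : ℝ, Real.exp (-((1 - α) * |z|))) * B := by
  have hB0 : 0 ≤ B := (mul_nonneg (abs_nonneg _) (hφ.pos 0).le).trans (hB 0)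
  have e : |conv K F x| * φ x = ‖∫ z, K z * F (x - z) * φ x‖ := by
    rw [integral_mul_const, norm_mul, Real.norm_eq_abs, Real.norm_of_nonneg (hφ.pos x).le, conv,
      convolution_mul]
  rw [e, ← integral_mul_const]
  refine norm_integral_le_of_norm_le
    ((integrable_exp_neg_mul_abs (sub_pos.2 hα)).mul_const B) (ae_of_all _ fun z => ?_)
  have h1 := hφ.le_mul x (x - z)
  rw [sub_sub_cancel] at h1
  rw [Real.norm_eq_abs, abs_mul, abs_mul, abs_of_pos (hφ.pos x)]
  calc |K z| * |F (x - z)| * φ x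
      ≤ (1 / 2 * Real.exp (-|z|)) * |F (x - z)| * (Real.exp (α * |z|) * φ (x - z)) := by
        gcongr
        · exact (hφ.pos x).le
        · exact hK z
    _ = 1 / 2 * Real.exp (-((1 - α) * |z|)) * (|F (x - z)| * φ (x - z)) := by
        rw [show -((1 - α) * |z|) = -|z| + α * |z| by ring, Real.exp_add]
        ring
    _ ≤ 1 * Real.exp (-((1 - α) * |z|)) * B := by
        gcongr
        · exact mul_nonneg (abs_nonneg _) (hφ.pos _).le
        · norm_num
        · exact hB _
    _ = _ := by ring

/-! ### Characteristics and the transport estimate -/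

/-- The mean value theorem without an order between the endpoints. -/
theorem exists_deriv_mul_sub_eq {f : ℝ → ℝ} (hf : Differentiable ℝ f) (x y : ℝ) :
    ∃ ξ ∈ uIcc x y, f y - f x = deriv f ξ * (y - x) := by
  rcases lt_trichotomy x y with h | rfl | h
  · obtain ⟨ξ, hξ, e⟩ := exists_deriv_eq_slope f h hf.continuous.continuousOn
      hf.differentiableOn
    refine ⟨ξ, by rw [uIcc_of_le h.le]; exact Ioo_subset_Icc_self hξ, ?_⟩
    rw [e, div_mul_cancel₀ _ (sub_pos.2 h).ne']
  · exact ⟨x, left_mem_uIcc, by simp⟩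
  · obtain ⟨ξ, hξ, e⟩ := exists_deriv_eq_slope f h hf.continuous.continuousOn
      hf.differentiableOn
    refine ⟨ξ, by rw [uIcc_of_ge h.le]; exact Ioo_subset_Icc_self hξ, ?_⟩
    rw [e, ← neg_sub x y, mul_neg, div_mul_cancel₀ _ (sub_pos.2 h).ne', neg_sub]

/-- A mean value inequality that asks for the derivative in the open interval only. -/
theorem abs_le_add_exp_of_abs_deriv_le_exp {D D' : ℝ → ℝ} {c Λ t : ℝ} (hΛ : 0 < Λ) (hc : 0 ≤ c)
    (ht : 0 ≤ t) (hD : ContinuousOn D (Icc 0 t)) (hD' : ∀ τ ∈ Ioo 0 t, HasDerivAt D (D' τ) τ)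
    (hle : ∀ τ ∈ Ioo 0 t, |D' τ| ≤ c * Real.exp (Λ * τ)) :
    |D t| ≤ |D 0| + c / Λ * Real.exp (Λ * t) := by
  have hE : ∀ τ, HasDerivAt (fun τ => c / Λ * Real.exp (Λ * τ)) (c * Real.exp (Λ * τ)) τ := by
    intro τ
    have := (((hasDerivAt_id τ).const_mul Λ).exp).const_mul (c / Λ)
    refine this.congr_deriv ?_
    simp only [id, mul_one]
    field_simp
  have hEc : Continuous fun τ => c / Λ * Real.exp (Λ * τ) := by fun_prop
  have hE0 : 0 ≤ c / Λ := by positivity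
  have h1 : MonotoneOn (fun τ => c / Λ * Real.exp (Λ * τ) - D τ) (Icc 0 t) := by
    refine monotoneOn_of_hasDerivWithinAt_nonneg (convex_Icc 0 t) (hEc.continuousOn.sub hD)
      (f' := fun τ => c * Real.exp (Λ * τ) - D' τ) (fun τ hτ => ?_) (fun τ hτ => ?_)
    · rw [interior_Icc] at hτ
      exact ((hE τ).sub (hD' τ hτ)).hasDerivWithinAt
    · rw [interior_Icc] at hτ
      linarith [le_abs_self (D' τ), hle τ hτ]
  have h2 : MonotoneOn (fun τ => c / Λ * Real.exp (Λ * τ) + D τ) (Icc 0 t) := by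
    refine monotoneOn_of_hasDerivWithinAt_nonneg (convex_Icc 0 t) (hEc.continuousOn.add hD)
      (f' := fun τ => c * Real.exp (Λ * τ) + D' τ) (fun τ hτ => ?_) (fun τ hτ => ?_)
    · rw [interior_Icc] at hτ
      exact ((hE τ).add (hD' τ hτ)).hasDerivWithinAt
    · rw [interior_Icc] at hτ
      linarith [neg_abs_le (D' τ), hle τ hτ]
  have m0 : (0 : ℝ) ∈ Icc 0 t := left_mem_Icc.2 ht
  have mt : t ∈ Icc 0 t := right_mem_Icc.2 ht
  have e1 := h1 m0 mt ht
  have e2 := h2 m0 mt ht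
  simp only [mul_zero, Real.exp_zero, mul_one] at e1 e2
  rw [abs_le]
  constructor <;> linarith [le_abs_self (D 0), neg_abs_le (D 0)]

section Characteristics

variable {T R : ℝ} {S : ℝ → ℝ → ℝ}

/-- The characteristic through any point `(t, x)` exists on all of `[0,T]`, because the velocity is
bounded and Lipschitz in space. -/
theorem IsC1Path.exists_characteristic (hS : IsC1Path T S) (hR : 0 ≤ R)
    (hSR : ∀ t ∈ Icc 0 T, ∀ x, |S t x| ≤ R ∧ |deriv (S t) x| ≤ R) {t : ℝ} (ht : t ∈ Icc 0 T)
    (x : ℝ) : ∃ q : ℝ → ℝ, q t = x ∧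
      ∀ τ ∈ Icc 0 T, HasDerivWithinAt q (S τ (q τ)) (Icc 0 T) τ := by
  have hT : 0 ≤ T := ht.1.trans ht.2
  have hPL : IsPicardLindelof S (⟨t, ht⟩ : Icc 0 T) x ⟨R * T, by positivity⟩ 0 ⟨R, hR⟩ ⟨R, hR⟩ := by
    refine ⟨fun τ hτ => ?_, fun y _ => ?_, fun τ hτ y _ => (hSR τ hτ y).1, ?_⟩
    · exact (lipschitzWith_of_nnnorm_deriv_le (hS.differentiable τ hτ)
        fun y => (hSR τ hτ y).2).lipschitzOnWith
    · exact hS.continuousOn.comp (f := fun τ => (τ, y)) (by fun_prop)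
        fun τ hτ => ⟨hτ, mem_univ _⟩
    · simp only [NNReal.coe_zero, sub_zero]
      exact mul_le_mul_of_nonneg_left (max_le (by linarith [ht.1]) ht.2) hR
  exact hPL.exists_eq_forall_mem_Icc_hasDerivWithinAt₀

theorem abs_characteristic_sub_le (hSR : ∀ t ∈ Icc 0 T, ∀ x, |S t x| ≤ R ∧ |deriv (S t) x| ≤ R)
    {q : ℝ → ℝ} (hq : ∀ τ ∈ Icc 0 T, HasDerivWithinAt q (S τ (q τ)) (Icc 0 T) τ) {t τ : ℝ}
    (ht : t ∈ Icc 0 T) (hτ : τ ∈ Icc 0 T) : |q τ - q t| ≤ R * T := by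
  have h := (convex_Icc 0 T).norm_image_sub_le_of_norm_hasDerivWithin_le hq
    (fun τ hτ => (hSR τ hτ _).1) ht hτ
  have hR : 0 ≤ R := (abs_nonneg _).trans (hSR t ht 0).1
  refine h.trans (mul_le_mul_of_nonneg_left ?_ hR)
  rw [Real.norm_eq_abs, abs_le]
  constructor <;> linarith [ht.1, ht.2, hτ.1, hτ.2]

/-- Two characteristics separate, backwards in time, at most by the factor `e^{RT}`. -/
theorem IsC1Path.abs_characteristic_sub_characteristic_le (hS : IsC1Path T S)
    (hSR : ∀ t ∈ Icc 0 T, ∀ x, |S t x| ≤ R ∧ |deriv (S t) x| ≤ R) {q₁ q₂ : ℝ → ℝ}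
    (hq₁ : ∀ τ ∈ Icc 0 T, HasDerivWithinAt q₁ (S τ (q₁ τ)) (Icc 0 T) τ)
    (hq₂ : ∀ τ ∈ Icc 0 T, HasDerivWithinAt q₂ (S τ (q₂ τ)) (Icc 0 T) τ) {t τ : ℝ}
    (ht : t ∈ Icc 0 T) (hτ : τ ∈ Icc 0 T) (hle : τ ≤ t) :
    |q₁ τ - q₂ τ| ≤ Real.exp (R * T) * |q₁ t - q₂ t| := by
  have hR : 0 ≤ R := (abs_nonneg _).trans (hSR t ht 0).1
  -- The function `e^{2Rσ} (q₁ - q₂)²` is nondecreasing, since `S` has Lipschitz constant `R`.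
  have hderiv : ∀ σ ∈ Icc 0 T, HasDerivWithinAt
      (fun σ => Real.exp (2 * R * σ) * (q₁ σ - q₂ σ) ^ 2)
      (Real.exp (2 * R * σ) * (2 * R * (q₁ σ - q₂ σ) ^ 2 +
        2 * (q₁ σ - q₂ σ) * (S σ (q₁ σ) - S σ (q₂ σ)))) (Icc 0 T) σ := by
    intro σ hσ
    have h1 : HasDerivAt (fun σ => Real.exp (2 * R * σ)) (Real.exp (2 * R * σ) * (2 * R * 1)) σ :=
      ((hasDerivAt_id σ).const_mul (2 * R)).exp
    refine (h1.hasDerivWithinAt.mul (((hq₁ σ hσ).sub (hq₂ σ hσ)).pow 2)).congr_deriv ?_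
    simp
    ring
  have hmono : MonotoneOn (fun σ => Real.exp (2 * R * σ) * (q₁ σ - q₂ σ) ^ 2) (Icc 0 T) := by
    refine monotoneOn_of_hasDerivWithinAt_nonneg (convex_Icc 0 T)
      (fun σ hσ => (hderiv σ hσ).continuousWithinAt)
      (fun σ hσ => (hderiv σ (interior_subset hσ)).mono interior_subset) (fun σ hσ => ?_)
    have hσ' := interior_subset hσ
    obtain ⟨ξ, -, e⟩ := exists_deriv_mul_sub_eq (hS.differentiable σ hσ') (q₂ σ) (q₁ σ)
    rw [e]
    have h2 : 0 ≤ R + deriv (S σ) ξ := by linarith [neg_abs_le (deriv (S σ) ξ), (hSR σ hσ' ξ).2]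
    have : 2 * R * (q₁ σ - q₂ σ) ^ 2 +
        2 * (q₁ σ - q₂ σ) * (deriv (S σ) ξ * (q₁ σ - q₂ σ)) =
        2 * (R + deriv (S σ) ξ) * (q₁ σ - q₂ σ) ^ 2 := by ring
    rw [this]
    positivity
  have h := hmono hτ ht hle
  refine abs_le_of_sq_le_sq ?_ (by positivity)
  rw [mul_pow, sq_abs]
  have e1 : 1 ≤ Real.exp (2 * R * τ) := Real.one_le_exp (by have := hτ.1; positivity)
  have e2 : Real.exp (2 * R * t) ≤ Real.exp (R * T) ^ 2 := by
    rw [← Real.exp_nat_mul, Real.exp_le_exp]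
    push_cast
    nlinarith [ht.2]
  calc (q₁ τ - q₂ τ) ^ 2 ≤ Real.exp (2 * R * τ) * (q₁ τ - q₂ τ) ^ 2 :=
        le_mul_of_one_le_left (sq_nonneg _) e1
    _ ≤ Real.exp (2 * R * t) * (q₁ t - q₂ t) ^ 2 := h
    _ ≤ _ := mul_le_mul_of_nonneg_right e2 (sq_nonneg _)

/-- The chain rule along a curve. Continuity of `∂ₜa` is not available, so the increment is split as
`[a(τ, q(τ)) - a(τ, q(t))] + [a(τ, q(t)) - a(t, q(t))]`; the first bracket is treated with the mean
value theorem in space and the joint continuity of `∂ₓa`. -/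
theorem IsC1Path.hasDerivAt_comp {a : ℝ → ℝ → ℝ} (ha : IsC1Path T a) {q : ℝ → ℝ} {t q' A : ℝ}
    (ht : t ∈ Ioo 0 T) (hq : HasDerivAt q q' t) (hA : HasDerivAt (fun τ => a τ (q t)) A t) :
    HasDerivAt (fun τ => a τ (q τ)) (A + deriv (a t) (q t) * q') t := by
  have hex : ∀ τ, ∃ ξ ∈ uIcc (q t) (q τ), τ ∈ Icc 0 T →
      a τ (q τ) - a τ (q t) = deriv (a τ) ξ * (q τ - q t) := by
    intro τ
    by_cases hτ : τ ∈ Icc 0 T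
    · obtain ⟨ξ, hξ, e⟩ := exists_deriv_mul_sub_eq (ha.differentiable τ hτ) (q t) (q τ)
      exact ⟨ξ, hξ, fun _ => e⟩
    · exact ⟨q t, left_mem_uIcc, fun h => absurd h hτ⟩
  choose ξ hξ hslope using hex
  have hmem : Icc 0 T ∈ 𝓝 t := Icc_mem_nhds ht.1 ht.2
  have hξt : Tendsto ξ (𝓝 t) (𝓝 (q t)) := by
    rw [tendsto_iff_dist_tendsto_zero]
    have h0 : Tendsto (fun τ => |q τ - q t|) (𝓝 t) (𝓝 0) := by
      simpa using (hq.continuousAt.tendsto.sub_const (q t)).abs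
    refine squeeze_zero (fun _ => dist_nonneg) (fun τ => ?_) h0
    rw [Real.dist_eq]
    exact abs_sub_left_of_mem_uIcc (hξ τ)
  have hc : Tendsto (fun τ => deriv (a τ) (ξ τ)) (𝓝 t) (𝓝 (deriv (a t) (q t))) := by
    have h1 : ContinuousAt (fun p : ℝ × ℝ => deriv (a p.1) p.2) (t, q t) :=
      ha.continuousOn_deriv.continuousAt (prod_mem_nhds hmem univ_mem)
    exact h1.tendsto.comp (tendsto_id.prodMk_nhds hξt)
  have hd : HasDerivAt (fun τ => a τ (q τ) - a τ (q t)) (deriv (a t) (q t) * q') t := by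
    rw [hasDerivAt_iff_tendsto_slope] at hq ⊢
    refine ((hc.mono_left nhdsWithin_le_nhds).mul hq).congr' ?_
    filter_upwards [nhdsWithin_le_nhds hmem] with τ hτ
    simp only [slope_def_field, sub_self, sub_zero]
    rw [hslope τ hτ]
    ring
  refine (hA.add hd).congr_of_eventuallyEq (Eventually.of_forall fun τ => ?_)
  simp

end Characteristics

theorem IsSlowWeight.abs_mul_le_of_abs_sub_le {α r M z x y : ℝ} {φ : ℝ → ℝ} (hα : 0 ≤ α)
    (hφ : IsSlowWeight α φ) (hxy : |x - y| ≤ r) (h : |z| * φ y ≤ M) :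
    |z| ≤ Real.exp (α * r) * M / φ x := by
  rw [le_div_iff₀ (hφ.pos x)]
  calc |z| * φ x ≤ |z| * (Real.exp (α * r) * φ y) := by
        refine mul_le_mul_of_nonneg_left ((hφ.le_mul x y).trans ?_) (abs_nonneg _)
        have := (hφ.pos y).le
        gcongr
    _ = Real.exp (α * r) * (|z| * φ y) := by ring
    _ ≤ _ := by gcongr

theorem abs_sub_le_of_mem_uIcc {a b z x r : ℝ} (hz : z ∈ uIcc a b) (ha : |x - a| ≤ r)
    (hb : |x - b| ≤ r) : |x - z| ≤ r := by
  rw [abs_le] at *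
  rcases mem_uIcc.1 hz with h | h <;> constructor <;> linarith [h.1, h.2]

/-- Weighted bounds for a solution of the transport equation `a_t + S a_x + P = 0` and for its space
derivative, in terms of weighted bounds for the initial data and for `P` and `P_x`. The bound on
`a_x` is obtained from a local Lipschitz bound, without a second derivative of `a`. -/
theorem IsC1Path.weighted_bound_of_transport {T R α Λ M A : ℝ} {S a P P' : ℝ → ℝ → ℝ} {φ : ℝ → ℝ}
    (hS : IsC1Path T S) (hSR : ∀ t ∈ Icc 0 T, ∀ x, |S t x| ≤ R ∧ |deriv (S t) x| ≤ R)
    (ha : IsC1Path T a) (hP : ∀ t ∈ Ioo 0 T, ∀ x, HasDerivAt (P t) (P' t x) x)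
    (heq : ∀ t ∈ Ioo 0 T, ∀ x,
      HasDerivAt (fun τ => a τ x) (-(S t x * deriv (a t) x + P t x)) t)
    (hα : 0 ≤ α) (hφ : IsSlowWeight α φ) (hΛ : 0 < Λ) (hA : 0 ≤ A)
    (h0 : ∀ x, |a 0 x| * φ x ≤ M ∧ |deriv (a 0) x| * φ x ≤ M)
    (hPA : ∀ t ∈ Ioo 0 T, ∀ x,
      |P t x| * φ x ≤ A * Real.exp (Λ * t) ∧ |P' t x| * φ x ≤ A * Real.exp (Λ * t))
    {t : ℝ} (ht : t ∈ Icc 0 T) (x : ℝ) :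
    |a t x| * φ x ≤
        Real.exp (α * (R * T + 1)) * Real.exp (R * T) * (M + A / Λ * Real.exp (Λ * t)) ∧
      |deriv (a t) x| * φ x ≤
        Real.exp (α * (R * T + 1)) * Real.exp (R * T) * (M + A / Λ * Real.exp (Λ * t)) := by
  have hR : 0 ≤ R := (abs_nonneg _).trans (hSR t ht 0).1
  have hT : 0 ≤ T := ht.1.trans ht.2
  have hM : 0 ≤ M := (mul_nonneg (abs_nonneg _) (hφ.pos 0).le).trans (h0 0).1
  have hφx := hφ.pos x
  set E := Real.exp (α * (R * T + 1)) with hE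
  have hE0 : 0 < E := Real.exp_pos _
  have hsub : ∀ {τ}, τ ∈ Ioo 0 t → τ ∈ Ioo 0 T := fun hτ => ⟨hτ.1, hτ.2.trans_le ht.2⟩
  have hcomp : ∀ q : ℝ → ℝ, (∀ τ ∈ Icc 0 T, HasDerivWithinAt q (S τ (q τ)) (Icc 0 T) τ) →
      ContinuousOn (fun τ => a τ (q τ)) (Icc 0 t) ∧
      ∀ τ ∈ Ioo 0 t, HasDerivAt (fun τ => a τ (q τ)) (-P τ (q τ)) τ := by
    intro q hq
    constructor
    · have hqc : ContinuousOn q (Icc 0 T) := fun τ hτ => (hq τ hτ).continuousWithinAt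
      exact (ha.continuousOn.comp (f := fun τ => (τ, q τ)) (continuousOn_id.prodMk hqc)
        fun τ hτ => ⟨hτ, mem_univ _⟩).mono (Icc_subset_Icc_right ht.2)
    · intro τ hτ
      have hτ := hsub hτ
      refine (ha.hasDerivAt_comp hτ ((hq τ (Ioo_subset_Icc_self hτ)).hasDerivAt
        (Icc_mem_nhds hτ.1 hτ.2)) (heq τ hτ (q τ))).congr_deriv (by ring)
  obtain ⟨q, hqt, hq⟩ := hS.exists_characteristic hR hSR ht x
  have hqx : ∀ τ ∈ Icc 0 T, |x - q τ| ≤ R * T := fun τ hτ => by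
    rw [abs_sub_comm, ← hqt]
    exact abs_characteristic_sub_le hSR hq ht hτ
  have m0 : (0 : ℝ) ∈ Icc 0 T := left_mem_Icc.2 hT
  constructor
  · obtain ⟨c, d⟩ := hcomp q hq
    have key := abs_le_add_exp_of_abs_deriv_le_exp hΛ (c := E * A / φ x) (by positivity) ht.1 c d
      (fun τ hτ => by
        have hτ := hsub hτ
        rw [abs_neg]
        refine (hφ.abs_mul_le_of_abs_sub_le hα
          ((hqx τ (Ioo_subset_Icc_self hτ)).trans (by linarith : R * T ≤ R * T + 1))
          (hPA τ hτ (q τ)).1).trans (le_of_eq ?_)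
        ring)
    rw [hqt] at key
    have k0 := hφ.abs_mul_le_of_abs_sub_le hα
      ((hqx 0 m0).trans (by linarith : R * T ≤ R * T + 1)) (h0 (q 0)).1
    rw [← hE] at k0
    have h1 : |a t x| ≤ E * (M + A / Λ * Real.exp (Λ * t)) / φ x := by
      refine (key.trans (add_le_add_left k0 _)).trans (le_of_eq ?_)
      field_simp
    rw [le_div_iff₀ hφx] at h1
    refine h1.trans ?_
    have h2 : 1 ≤ Real.exp (R * T) := Real.one_le_exp (by positivity)
    have h3 : 0 ≤ M + A / Λ * Real.exp (Λ * t) := by positivity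
    refine mul_le_mul_of_nonneg_right ?_ h3
    exact le_mul_of_one_le_right hE0.le h2
  · rw [← le_div_iff₀ hφx]
    refine ((ha.differentiable t ht x).hasDerivAt).le_of_lip' (by positivity) ?_
    -- For `y` close to `x`, the two characteristics stay within distance `1` of each other, so that
    -- the weight at any point between them is comparable with the weight at `x`.
    have hnear : ∀ᶠ y in 𝓝 x, Real.exp (R * T) * |x - y| < 1 := by
      have : ContinuousAt (fun y => Real.exp (R * T) * |x - y|) x := by fun_prop
      refine this.eventually_lt continuousAt_const ?_
      simp
    filter_upwards [hnear] with y hy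
    obtain ⟨p, hpt, hp⟩ := hS.exists_characteristic hR hSR ht y
    have hdist : ∀ τ ∈ Icc 0 T, τ ≤ t → |q τ - p τ| ≤ Real.exp (R * T) * |x - y| := by
      intro τ hτ hle
      have := hS.abs_characteristic_sub_characteristic_le hSR hq hp ht hτ hle
      rwa [hqt, hpt] at this
    have hpx : ∀ τ ∈ Icc 0 T, τ ≤ t → |x - p τ| ≤ R * T + 1 := fun τ hτ hle =>
      (abs_sub_le x (q τ) (p τ)).trans
        (add_le_add (hqx τ hτ) ((hdist τ hτ hle).trans hy.le))
    have hqx' : ∀ τ ∈ Icc 0 T, |x - q τ| ≤ R * T + 1 := fun τ hτ =>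
      (hqx τ hτ).trans (by linarith)
    obtain ⟨c₁, d₁⟩ := hcomp q hq
    obtain ⟨c₂, d₂⟩ := hcomp p hp
    have key := abs_le_add_exp_of_abs_deriv_le_exp hΛ
      (c := E * A / φ x * (Real.exp (R * T) * |x - y|)) (by positivity) ht.1 (c₁.sub c₂)
      (fun τ hτ => (d₁ τ hτ).sub (d₂ τ hτ)) (fun τ hτ => by
        have hτ' := hsub hτ
        have hτI := Ioo_subset_Icc_self hτ'
        obtain ⟨ξ, hξ, e⟩ := exists_deriv_mul_sub_eq
          (fun z => (hP τ hτ' z).differentiableAt) (q τ) (p τ)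
        have hξx := abs_sub_le_of_mem_uIcc hξ (hqx' τ hτI) (hpx τ hτI hτ.2.le)
        rw [show -P τ (q τ) - -P τ (p τ) = P τ (p τ) - P τ (q τ) by ring, e,
          (hP τ hτ' ξ).deriv, abs_mul, abs_sub_comm (p τ)]
        calc |P' τ ξ| * |q τ - p τ|
            ≤ (E * (A * Real.exp (Λ * τ)) / φ x) * (Real.exp (R * T) * |x - y|) :=
              mul_le_mul (hφ.abs_mul_le_of_abs_sub_le hα hξx (hPA τ hτ' ξ).2)
                (hdist τ hτI hτ.2.le) (abs_nonneg _) (by positivity)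
          _ = _ := by ring)
    have k0 : |a 0 (q 0) - a 0 (p 0)| ≤ E * M / φ x * (Real.exp (R * T) * |x - y|) := by
      obtain ⟨ξ, hξ, e⟩ := exists_deriv_mul_sub_eq (ha.differentiable 0 m0) (q 0) (p 0)
      have hξx := abs_sub_le_of_mem_uIcc hξ (hqx' 0 m0) (hpx 0 m0 ht.1)
      rw [abs_sub_comm, e, abs_mul, abs_sub_comm (p 0)]
      exact mul_le_mul (hφ.abs_mul_le_of_abs_sub_le hα hξx (h0 ξ).2)
        (hdist 0 m0 ht.1) (abs_nonneg _) (by positivity)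
    rw [Pi.sub_apply, Pi.sub_apply, hqt, hpt] at key
    rw [Real.norm_eq_abs, Real.norm_eq_abs, abs_sub_comm, abs_sub_comm y]
    refine (key.trans (add_le_add_left k0 _)).trans (le_of_eq ?_)
    field_simp

/-! ### Weighted bounds for solutions -/

theorem IsC1Path.continuous_deriv {T : ℝ} {a : ℝ → ℝ → ℝ} (ha : IsC1Path T a) {t : ℝ}
    (ht : t ∈ Icc 0 T) : Continuous (deriv (a t)) :=
  continuousOn_univ.1 <| ha.continuousOn_deriv.comp (f := fun x => (t, x)) (by fun_prop)
    fun _ _ => ⟨ht, mem_univ _⟩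

theorem IsC1Path.add {T : ℝ} {a b : ℝ → ℝ → ℝ} (ha : IsC1Path T a) (hb : IsC1Path T b) :
    IsC1Path T fun t x => a t x + b t x := by
  have hd : ∀ t ∈ Icc 0 T, ∀ x,
      deriv (fun x => a t x + b t x) x = deriv (a t) x + deriv (b t) x := fun t ht x =>
    deriv_fun_add (ha.differentiable t ht x) (hb.differentiable t ht x)
  refine ⟨fun t ht => (ha.differentiable t ht).add (hb.differentiable t ht),
    ha.continuousOn.add hb.continuousOn, ?_, ?_⟩
  · exact (ha.continuousOn_deriv.add hb.continuousOn_deriv).congr fun p hp => hd _ hp.1 _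
  · obtain ⟨R₁, h₁, H₁⟩ := ha.bounded
    obtain ⟨R₂, h₂, H₂⟩ := hb.bounded
    refine ⟨R₁ + R₂, by positivity, fun t ht x => ⟨?_, ?_⟩⟩
    · exact (abs_add_le _ _).trans (add_le_add (H₁ t ht x).1 (H₂ t ht x).1)
    · rw [hd t ht]
      exact (abs_add_le _ _).trans (add_le_add (H₁ t ht x).2 (H₂ t ht x).2)

/-- The nonlocal source `G ∗ (a b_x + a c_x) + ∂ₓG ∗ flux a b c` in the equation for `a`. -/
noncomputable def source (a b c : ℝ → ℝ) (x : ℝ) : ℝ :=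
  conv G (fun y => a y * deriv b y + a y * deriv c y) x + conv dG (flux a b c) x

/-- The space derivative of `source a b c`, computed with `∂ₓ²G = G - δ`. -/
noncomputable def sourceDeriv (a b c : ℝ → ℝ) (x : ℝ) : ℝ :=
  conv dG (fun y => a y * deriv b y + a y * deriv c y) x + (conv G (flux a b c) x - flux a b c x)

theorem abs_mul_mul_le {p q m R B : ℝ} (hp : |p| ≤ R) (hq : |q| * m ≤ B) (hB : 0 ≤ B) :
    |p * q| * m ≤ R * B := by
  rw [abs_mul, mul_assoc]
  exact (mul_le_mul_of_nonneg_left hq (abs_nonneg p)).trans (mul_le_mul_of_nonneg_right hp hB)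

section Source

variable {a b c φ : ℝ → ℝ} {R B : ℝ}

theorem abs_advection_mul_le (hm : ∀ x, 0 < φ x) (ha : ∀ x, |a x| ≤ R ∧ |deriv a x| ≤ R)
    (hb' : ∀ x, |b x| * φ x ≤ B ∧ |deriv b x| * φ x ≤ B)
    (hc' : ∀ x, |c x| * φ x ≤ B ∧ |deriv c x| * φ x ≤ B) (x : ℝ) :
    |a x * deriv b x + a x * deriv c x| * φ x ≤ 2 * R * B := by
  have hB : 0 ≤ B := (mul_nonneg (abs_nonneg _) (hm x).le).trans (hb' x).1
  have h1 := abs_mul_mul_le (ha x).1 (hb' x).2 hB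
  have h2 := abs_mul_mul_le (ha x).1 (hc' x).2 hB
  have h3 := mul_le_mul_of_nonneg_right (abs_add_le (a x * deriv b x) (a x * deriv c x)) (hm x).le
  linarith

theorem abs_flux_mul_le (hm : ∀ x, 0 < φ x) (ha : ∀ x, |a x| ≤ R ∧ |deriv a x| ≤ R)
    (hb : ∀ x, |b x| ≤ R ∧ |deriv b x| ≤ R) (hc : ∀ x, |c x| ≤ R ∧ |deriv c x| ≤ R)
    (ha' : ∀ x, |a x| * φ x ≤ B ∧ |deriv a x| * φ x ≤ B)
    (hb' : ∀ x, |b x| * φ x ≤ B ∧ |deriv b x| * φ x ≤ B)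
    (hc' : ∀ x, |c x| * φ x ≤ B ∧ |deriv c x| * φ x ≤ B) (x : ℝ) :
    |flux a b c x| * φ x ≤ 6 * R * B := by
  have hB : 0 ≤ B := (mul_nonneg (abs_nonneg _) (hm x).le).trans (hb' x).1
  have hR : 0 ≤ R := (abs_nonneg _).trans (ha x).1
  have key : ∀ p q : ℝ, |p| ≤ R → |q| * φ x ≤ B →
      p * q * φ x ≤ R * B ∧ -(R * B) ≤ p * q * φ x := by
    intro p q hp hq
    have h := abs_mul_mul_le hp hq hB
    rw [← abs_of_pos (hm x), ← abs_mul, abs_le] at h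
    exact ⟨h.2, h.1⟩
  have hRB : 0 ≤ R * B := by positivity
  have k1 := key _ _ (ha x).1 (ha' x).1
  have k2 := key _ _ (ha x).2 (ha' x).2
  have k3 := key _ _ (ha x).2 (hb' x).2
  have k4 := key _ _ (ha x).2 (hc' x).2
  have k5 := key _ _ (hb x).1 (hb' x).1
  have k6 := key _ _ (hb x).2 (hb' x).2
  have k7 := key _ _ (hc x).1 (hc' x).1
  have k8 := key _ _ (hc x).2 (hc' x).2
  have e : flux a b c x * φ x = a x * a x * φ x + 1 / 2 * (deriv a x * deriv a x * φ x)
      + deriv a x * deriv b x * φ x + deriv a x * deriv c x * φ x + 1 / 2 * (b x * b x * φ x)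
      - 1 / 2 * (deriv b x * deriv b x * φ x) + 1 / 2 * (c x * c x * φ x)
      - 1 / 2 * (deriv c x * deriv c x * φ x) := by
    rw [flux]; ring
  rw [← abs_of_pos (hm x), ← abs_mul, e, abs_le]
  constructor <;>
    linarith [k1.1, k1.2, k2.1, k2.2, k3.1, k3.2, k4.1, k4.2, k5.1, k5.2, k6.1, k6.2, k7.1, k7.2,
      k8.1, k8.2]

theorem hasDerivAt_source (ha : Continuous a) (ha₁ : Continuous (deriv a)) (hb : Continuous b)
    (hb₁ : Continuous (deriv b)) (hc : Continuous c) (hc₁ : Continuous (deriv c))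
    (hRa : ∀ x, |a x| ≤ R ∧ |deriv a x| ≤ R) (hRb : ∀ x, |b x| ≤ R ∧ |deriv b x| ≤ R)
    (hRc : ∀ x, |c x| ≤ R ∧ |deriv c x| ≤ R) (x : ℝ) :
    HasDerivAt (source a b c) (sourceDeriv a b c x) x := by
  have hflux : Continuous (flux a b c) := by
    unfold flux
    fun_prop
  -- The constant weight `1` turns the weighted estimates into boundedness.
  have h1 := abs_advection_mul_le (φ := fun _ => 1) (B := R) (fun _ => one_pos) hRa
    (by simpa using hRb) (by simpa using hRc)
  have h2 := abs_flux_mul_le (φ := fun _ => 1) (B := R) (fun _ => one_pos) hRa hRb hRc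
    (by simpa using hRa) (by simpa using hRb) (by simpa using hRc)
  simp only [mul_one] at h1 h2
  exact (hasDerivAt_conv_G (by fun_prop) h1 x).add (hasDerivAt_conv_dG hflux h2 x)

theorem IsSlowWeight.abs_source_mul_le {α : ℝ} (hα : α < 1) (hφ : IsSlowWeight α φ)
    (hRa : ∀ x, |a x| ≤ R ∧ |deriv a x| ≤ R) (hRb : ∀ x, |b x| ≤ R ∧ |deriv b x| ≤ R)
    (hRc : ∀ x, |c x| ≤ R ∧ |deriv c x| ≤ R)
    (ha' : ∀ x, |a x| * φ x ≤ B ∧ |deriv a x| * φ x ≤ B)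
    (hb' : ∀ x, |b x| * φ x ≤ B ∧ |deriv b x| * φ x ≤ B)
    (hc' : ∀ x, |c x| * φ x ≤ B ∧ |deriv c x| * φ x ≤ B) (x : ℝ) :
    |source a b c x| * φ x ≤ (8 * (∫ z : ℝ, Real.exp (-((1 - α) * |z|))) + 6) * R * B ∧
      |sourceDeriv a b c x| * φ x ≤
        (8 * (∫ z : ℝ, Real.exp (-((1 - α) * |z|))) + 6) * R * B := by
  have hm := (hφ.pos x).le
  have hB : 0 ≤ B := (mul_nonneg (abs_nonneg _) hm).trans (hb' x).1
  have hR : 0 ≤ R := (abs_nonneg _).trans (hRa x).1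
  have hRB : 0 ≤ R * B := by positivity
  have h1 := abs_advection_mul_le hφ.pos hRa hb' hc'
  have h2 := abs_flux_mul_le hφ.pos hRa hRb hRc ha' hb' hc'
  constructor
  · have e1 := hφ.abs_conv_mul_le hα abs_G_le h1 x
    have e2 := hφ.abs_conv_mul_le hα abs_dG_le h2 x
    have e3 := mul_le_mul_of_nonneg_right (abs_add_le
      (conv G (fun y => a y * deriv b y + a y * deriv c y) x) (conv dG (flux a b c) x)) hm
    rw [source]
    linarith
  · have e1 := hφ.abs_conv_mul_le hα abs_dG_le h1 x
    have e2 := hφ.abs_conv_mul_le hα abs_G_le h2 x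
    have e3 := mul_le_mul_of_nonneg_right (abs_add_le
      (conv dG (fun y => a y * deriv b y + a y * deriv c y) x)
      (conv G (flux a b c) x - flux a b c x)) hm
    have e4 := mul_le_mul_of_nonneg_right (abs_sub (conv G (flux a b c) x) (flux a b c x)) hm
    have e5 := h2 x
    rw [sourceDeriv]
    linarith

end Source

/-- The functions `a t` and their space derivatives are bounded by `B e^{Λt}` in the supremum norm
weighted by `φ`, for all `t ∈ [0,T]`. -/
def WeightedBound (T Λ : ℝ) (φ : ℝ → ℝ) (B : ℝ) (a : ℝ → ℝ → ℝ) : Prop :=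
  ∀ t ∈ Icc 0 T, ∀ x,
    |a t x| * φ x ≤ B * Real.exp (Λ * t) ∧ |deriv (a t) x| * φ x ≤ B * Real.exp (Λ * t)

/-- The contraction step: if `Λ` is large, then weighted bounds with constant `B` for the three
components imply one with constant `D M + B / 2` for the first, where `M` is a weighted bound for
its initial data. -/
theorem WeightedBound.improve {T R α Λ M B D : ℝ} {φ : ℝ → ℝ} {a b c : ℝ → ℝ → ℝ}
    (ha : IsC1Path T a) (hb : IsC1Path T b) (hc : IsC1Path T c)
    (hRa : ∀ t ∈ Icc 0 T, ∀ x, |a t x| ≤ R ∧ |deriv (a t) x| ≤ R)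
    (hRb : ∀ t ∈ Icc 0 T, ∀ x, |b t x| ≤ R ∧ |deriv (b t) x| ≤ R)
    (hRc : ∀ t ∈ Icc 0 T, ∀ x, |c t x| ≤ R ∧ |deriv (c t) x| ≤ R)
    (heq : ∀ t ∈ Ioo 0 T, ∀ x, HasDerivAt (fun τ => a τ x) (rhs (a t) (b t) (c t) x) t)
    (hα : α ∈ Ioo 0 1) (hφ : IsSlowWeight α φ)
    (hD : D = Real.exp (α * (3 * R * T + 1)) * Real.exp (3 * R * T)) (hΛ : 0 < Λ)
    (hDΛ : 2 * D * ((8 * (∫ z : ℝ, Real.exp (-((1 - α) * |z|))) + 6) * R) ≤ Λ)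
    (h0 : ∀ x, |a 0 x| * φ x ≤ M ∧ |deriv (a 0) x| * φ x ≤ M)
    (ha' : WeightedBound T Λ φ B a) (hb' : WeightedBound T Λ φ B b)
    (hc' : WeightedBound T Λ φ B c) : WeightedBound T Λ φ (D * M + B / 2) a := by
  intro t ht x
  have hT : 0 ≤ T := ht.1.trans ht.2
  have m0 : (0 : ℝ) ∈ Icc 0 T := left_mem_Icc.2 hT
  have hB : 0 ≤ B := by
    have := (ha' 0 m0 0).1
    rw [mul_zero, Real.exp_zero, mul_one] at this
    exact (mul_nonneg (abs_nonneg _) (hφ.pos 0).le).trans this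
  have hM : 0 ≤ M := (mul_nonneg (abs_nonneg _) (hφ.pos 0).le).trans (h0 0).1
  have hR : 0 ≤ R := (abs_nonneg _).trans (hRa 0 m0 0).1
  have hD0 : 0 < D := by rw [hD]; positivity
  set k := (8 * (∫ z : ℝ, Real.exp (-((1 - α) * |z|))) + 6) * R with hk
  have hk0 : 0 ≤ k := by
    have : 0 ≤ ∫ z : ℝ, Real.exp (-((1 - α) * |z|)) := integral_nonneg fun z => (Real.exp_pos _).le
    positivity
  have hS := (ha.add hb).add hc
  have hSR : ∀ t ∈ Icc 0 T, ∀ x, |a t x + b t x + c t x| ≤ 3 * R ∧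
      |deriv (fun x => a t x + b t x + c t x) x| ≤ 3 * R := by
    intro t ht x
    have h1 := hRa t ht x
    have h2 := hRb t ht x
    have h3 := hRc t ht x
    have da := ha.differentiable t ht x
    have db := hb.differentiable t ht x
    have dc := hc.differentiable t ht x
    rw [deriv_fun_add (da.fun_add db) dc, deriv_fun_add da db]
    exact ⟨(abs_add_three _ _ _).trans (by linarith), (abs_add_three _ _ _).trans (by linarith)⟩
  have hcont : ∀ {f : ℝ → ℝ → ℝ}, IsC1Path T f → ∀ t ∈ Icc 0 T, Continuous (f t) :=
    fun hf t ht => (hf.differentiable t ht).continuous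
  have key := hS.weighted_bound_of_transport (A := k * B)
    (P := fun t => source (a t) (b t) (c t)) (P' := fun t => sourceDeriv (a t) (b t) (c t))
    hSR ha
    (fun t ht x => by
      have ht := Ioo_subset_Icc_self ht
      exact hasDerivAt_source (hcont ha t ht) (ha.continuous_deriv ht) (hcont hb t ht)
        (hb.continuous_deriv ht) (hcont hc t ht) (hc.continuous_deriv ht) (hRa t ht) (hRb t ht)
        (hRc t ht) x)
    (fun t ht x => (heq t ht x).congr_deriv (by rw [rhs, source, add_assoc]))
    hα.1.le hφ hΛ (by positivity) h0
    (fun t ht x => by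
      have ht := Ioo_subset_Icc_self ht
      have := hφ.abs_source_mul_le hα.2 (hRa t ht) (hRb t ht) (hRc t ht) (ha' t ht) (hb' t ht)
        (hc' t ht) x
      rwa [← hk, ← mul_assoc] at this)
    ht x
  rw [← hD] at key
  have hexp : 1 ≤ Real.exp (Λ * t) := Real.one_le_exp (by have := ht.1; positivity)
  have h1 : D * (k * B / Λ) ≤ B / 2 := by
    rw [mul_div_assoc', div_le_div_iff₀ hΛ two_pos]
    nlinarith [mul_le_mul_of_nonneg_right hDΛ hB]
  have hfin : D * (M + k * B / Λ * Real.exp (Λ * t)) ≤ (D * M + B / 2) * Real.exp (Λ * t) := by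
    have h2 : D * M ≤ D * M * Real.exp (Λ * t) := le_mul_of_one_le_right (by positivity) hexp
    have h3 := mul_le_mul_of_nonneg_right h1 (Real.exp_pos (Λ * t)).le
    linarith
  exact ⟨key.1.trans hfin, key.2.trans hfin⟩

theorem DecaysAtTop.exists_mul_exp_le {α R : ℝ} {f : ℝ → ℝ} (hα : 0 ≤ α) (hf : DecaysAtTop α f)
    (hR : ∀ x, |f x| ≤ R) : ∃ M, 0 ≤ M ∧ ∀ x, |f x| * Real.exp (α * x) ≤ M := by
  obtain ⟨C, hC, h⟩ := hf.exists_pos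
  obtain ⟨X, hX⟩ := eventually_atTop.1 h.bound
  have hR0 : 0 ≤ R := (abs_nonneg _).trans (hR 0)
  refine ⟨C + R * Real.exp (α * X), by positivity, fun x => ?_⟩
  rcases le_total X x with hx | hx
  · have h1 := hX x hx
    rw [Real.norm_eq_abs, Real.norm_of_nonneg (Real.exp_pos _).le] at h1
    calc |f x| * Real.exp (α * x) ≤ C * Real.exp (-α * x) * Real.exp (α * x) := by gcongr
      _ = C := by rw [mul_assoc, ← Real.exp_add]; simp
      _ ≤ _ := le_add_of_nonneg_right (by positivity)
  · calc |f x| * Real.exp (α * x) ≤ R * Real.exp (α * X) := by gcongr; exact hR x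
      _ ≤ _ := le_add_of_nonneg_left hC.le

theorem le_of_forall_le_add_div_two_pow {y d B : ℝ} (h : ∀ n : ℕ, y ≤ d + B / 2 ^ n) : y ≤ d := by
  have h1 : Tendsto (fun n : ℕ => d + B / 2 ^ n) atTop (𝓝 (d + 0)) :=
    tendsto_const_nhds.add (tendsto_const_nhds.div_atTop
      (tendsto_pow_atTop_atTop_of_one_lt one_lt_two))
  rw [add_zero] at h1
  exact ge_of_tendsto' h1 h

theorem decaysAtTopUniformly_of_weightedBound {T α Λ d : ℝ} {a : ℝ → ℝ → ℝ} (hΛ : 0 ≤ Λ)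
    (hd : 0 ≤ d)
    (h : ∀ N > 0, WeightedBound T Λ (fun x => min (Real.exp (α * x)) N) d a) :
    DecaysAtTopUniformly α T a ∧ DecaysAtTopUniformly α T fun t => deriv (a t) := by
  have key : ∀ z x t : ℝ, t ≤ T →
      |z| * min (Real.exp (α * x)) (Real.exp (α * x)) ≤ d * Real.exp (Λ * t) →
      |z| ≤ (d * Real.exp (Λ * T) + 1) * Real.exp (-α * x) := by
    intro z x t ht hz
    rw [min_self] at hz
    calc |z| = |z| * Real.exp (α * x) * Real.exp (-α * x) := by
          rw [mul_assoc, ← Real.exp_add]; simp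
      _ ≤ _ := by
          gcongr
          refine hz.trans ?_
          have : Real.exp (Λ * t) ≤ Real.exp (Λ * T) := by gcongr
          nlinarith
  exact ⟨⟨_, by positivity, 0, fun t ht x _ => key _ x t ht.2 (h _ (Real.exp_pos _) t ht x).1⟩,
    ⟨_, by positivity, 0, fun t ht x _ => key _ x t ht.2 (h _ (Real.exp_pos _) t ht x).2⟩⟩

end ThreeCH

open ThreeCH in
theorem corollary3p1 (s : ℝ) (hs : 3 / 2 < s) (T : ℝ) (hT : 0 < T)
    (u₀ v₀ w₀ : ℝ → ℝ)
    (hu₀ : ThreeCH.MemHs s u₀) (hv₀ : ThreeCH.MemHs s v₀) (hw₀ : ThreeCH.MemHs s w₀)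
    (u v w : ℝ → ℝ → ℝ) (hz : ThreeCH.IsSolution s T u₀ v₀ w₀ u v w)
    (α : ℝ) (hα : α ∈ Set.Ioo (0 : ℝ) 1)
    (hdu₀ : ThreeCH.DecaysAtTop α u₀) (hdv₀ : ThreeCH.DecaysAtTop α v₀)
    (hdw₀ : ThreeCH.DecaysAtTop α w₀)
    (hdu₀' : ThreeCH.DecaysAtTop α (deriv u₀)) (hdv₀' : ThreeCH.DecaysAtTop α (deriv v₀))
    (hdw₀' : ThreeCH.DecaysAtTop α (deriv w₀)) :
    ThreeCH.DecaysAtTopUniformly α T u ∧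
    ThreeCH.DecaysAtTopUniformly α T v ∧
    ThreeCH.DecaysAtTopUniformly α T w ∧
    ThreeCH.DecaysAtTopUniformly α T (fun t => deriv (u t)) ∧
    ThreeCH.DecaysAtTopUniformly α T (fun t => deriv (v t)) ∧
    ThreeCH.DecaysAtTopUniformly α T (fun t => deriv (w t)) := by
  have hu := hz.cont_u.isC1Path hs
  have hv := hz.cont_v.isC1Path hs
  have hw := hz.cont_w.isC1Path hs
  obtain ⟨Ru, hRu0, hRu⟩ := hu.bounded
  obtain ⟨Rv, hRv0, hRv⟩ := hv.bounded
  obtain ⟨Rw, hRw0, hRw⟩ := hw.bounded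
  obtain ⟨R, hR⟩ : ∃ R, R = Ru + Rv + Rw := ⟨_, rfl⟩
  have hR0 : 0 ≤ R := by linarith
  replace hRu : ∀ t ∈ Icc 0 T, ∀ x, |u t x| ≤ R ∧ |deriv (u t) x| ≤ R := fun t ht x =>
    ⟨by linarith [(hRu t ht x).1], by linarith [(hRu t ht x).2]⟩
  replace hRv : ∀ t ∈ Icc 0 T, ∀ x, |v t x| ≤ R ∧ |deriv (v t) x| ≤ R := fun t ht x =>
    ⟨by linarith [(hRv t ht x).1], by linarith [(hRv t ht x).2]⟩
  replace hRw : ∀ t ∈ Icc 0 T, ∀ x, |w t x| ≤ R ∧ |deriv (w t) x| ≤ R := fun t ht x =>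
    ⟨by linarith [(hRw t ht x).1], by linarith [(hRw t ht x).2]⟩
  have m0 : (0 : ℝ) ∈ Icc 0 T := left_mem_Icc.2 hT.le
  rw [← hz.init_u] at hdu₀ hdu₀'
  rw [← hz.init_v] at hdv₀ hdv₀'
  rw [← hz.init_w] at hdw₀ hdw₀'
  obtain ⟨M₁, p₁, h₁⟩ := hdu₀.exists_mul_exp_le hα.1.le fun x => (hRu 0 m0 x).1
  obtain ⟨M₂, p₂, h₂⟩ := hdv₀.exists_mul_exp_le hα.1.le fun x => (hRv 0 m0 x).1
  obtain ⟨M₃, p₃, h₃⟩ := hdw₀.exists_mul_exp_le hα.1.le fun x => (hRw 0 m0 x).1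
  obtain ⟨M₄, p₄, h₄⟩ := hdu₀'.exists_mul_exp_le hα.1.le fun x => (hRu 0 m0 x).2
  obtain ⟨M₅, p₅, h₅⟩ := hdv₀'.exists_mul_exp_le hα.1.le fun x => (hRv 0 m0 x).2
  obtain ⟨M₆, p₆, h₆⟩ := hdw₀'.exists_mul_exp_le hα.1.le fun x => (hRw 0 m0 x).2
  obtain ⟨M, hM⟩ : ∃ M, M = M₁ + M₂ + M₃ + M₄ + M₅ + M₆ := ⟨_, rfl⟩
  have hM0 : 0 ≤ M := by linarith
  obtain ⟨D, hD⟩ : ∃ D, D = Real.exp (α * (3 * R * T + 1)) * Real.exp (3 * R * T) := ⟨_, rfl⟩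
  have hD0 : 0 < D := by rw [hD]; positivity
  obtain ⟨Λ, hΛ⟩ : ∃ Λ,
    Λ = 2 * D * ((8 * (∫ z : ℝ, Real.exp (-((1 - α) * |z|))) + 6) * R) + 1 := ⟨_, rfl⟩
  have hΛ0 : 0 < Λ := by
    have : 0 ≤ ∫ z : ℝ, Real.exp (-((1 - α) * |z|)) := integral_nonneg fun z => (Real.exp_pos _).le
    rw [hΛ]
    positivity
  have hDΛ : 2 * D * ((8 * (∫ z : ℝ, Real.exp (-((1 - α) * |z|))) + 6) * R) ≤ Λ := by
    rw [hΛ]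
    linarith
  have main : ∀ N > 0,
      WeightedBound T Λ (fun x => min (Real.exp (α * x)) N) (2 * (D * M)) u ∧
      WeightedBound T Λ (fun x => min (Real.exp (α * x)) N) (2 * (D * M)) v ∧
      WeightedBound T Λ (fun x => min (Real.exp (α * x)) N) (2 * (D * M)) w := by
    intro N hN
    have hφ := isSlowWeight_min_exp hα.1.le hN
    have hinit : ∀ {f : ℝ → ℝ} {m : ℝ}, (∀ x, |f x| * Real.exp (α * x) ≤ m) → m ≤ M →
        ∀ x, |f x| * min (Real.exp (α * x)) N ≤ M := fun h hm x =>
      (mul_le_mul_of_nonneg_left (min_le_left _ _) (abs_nonneg _)).trans ((h x).trans hm)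
    have hstart : ∀ {a : ℝ → ℝ → ℝ},
        (∀ t ∈ Icc 0 T, ∀ x, |a t x| ≤ R ∧ |deriv (a t) x| ≤ R) →
        WeightedBound T Λ (fun x => min (Real.exp (α * x)) N) (2 * (D * M) + R * N) a := by
      intro a h t ht x
      have e : ∀ z : ℝ, |z| ≤ R → |z| * min (Real.exp (α * x)) N ≤
          (2 * (D * M) + R * N) * Real.exp (Λ * t) := by
        intro z hz
        have h1 : 1 ≤ Real.exp (Λ * t) := Real.one_le_exp (by have := ht.1; positivity)
        calc |z| * min (Real.exp (α * x)) N ≤ R * N :=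
              mul_le_mul hz (min_le_right _ _) (le_min (Real.exp_pos _).le hN.le) hR0
          _ ≤ 2 * (D * M) + R * N := le_add_of_nonneg_left (by positivity)
          _ ≤ _ := le_mul_of_one_le_right (by positivity) h1
      exact ⟨e _ (h t ht x).1, e _ (h t ht x).2⟩
    have iter : ∀ n : ℕ,
        WeightedBound T Λ (fun x => min (Real.exp (α * x)) N) (2 * (D * M) + R * N / 2 ^ n) u ∧
        WeightedBound T Λ (fun x => min (Real.exp (α * x)) N) (2 * (D * M) + R * N / 2 ^ n) v ∧
        WeightedBound T Λ (fun x => min (Real.exp (α * x)) N) (2 * (D * M) + R * N / 2 ^ n) w := by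
      intro n
      induction n with
      | zero => simpa using ⟨hstart hRu, hstart hRv, hstart hRw⟩
      | succ n ih =>
        obtain ⟨iu, iv, iw⟩ := ih
        have e : 2 * (D * M) + R * N / 2 ^ (n + 1) =
            D * M + (2 * (D * M) + R * N / 2 ^ n) / 2 := by
          rw [pow_succ]
          field_simp
          ring
        rw [e]
        exact ⟨iu.improve hu hv hw hRu hRv hRw hz.eq_u hα hφ hD hΛ0 hDΛ
            (fun x => ⟨hinit h₁ (by linarith) x, hinit h₄ (by linarith) x⟩) iv iw,
          iv.improve hv hu hw hRv hRu hRw hz.eq_v hα hφ hD hΛ0 hDΛ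
            (fun x => ⟨hinit h₂ (by linarith) x, hinit h₅ (by linarith) x⟩) iu iw,
          iw.improve hw hu hv hRw hRu hRv hz.eq_w hα hφ hD hΛ0 hDΛ
            (fun x => ⟨hinit h₃ (by linarith) x, hinit h₆ (by linarith) x⟩) iu iv⟩
    have lim : ∀ {a : ℝ → ℝ → ℝ},
        (∀ n : ℕ, WeightedBound T Λ (fun x => min (Real.exp (α * x)) N)
          (2 * (D * M) + R * N / 2 ^ n) a) →
        WeightedBound T Λ (fun x => min (Real.exp (α * x)) N) (2 * (D * M)) a := by
      intro a h t ht x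
      have e : ∀ y, (∀ n : ℕ, y ≤ (2 * (D * M) + R * N / 2 ^ n) * Real.exp (Λ * t)) →
          y ≤ 2 * (D * M) * Real.exp (Λ * t) := fun y hy =>
        le_of_forall_le_add_div_two_pow (B := R * N * Real.exp (Λ * t)) fun n =>
          (hy n).trans (le_of_eq (by ring))
      exact ⟨e _ fun n => (h n t ht x).1, e _ fun n => (h n t ht x).2⟩
    exact ⟨lim fun n => (iter n).1, lim fun n => (iter n).2.1, lim fun n => (iter n).2.2⟩
  have hd : 0 ≤ 2 * (D * M) := by positivity
  obtain ⟨hu_decay, hu_deriv⟩ :=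
    decaysAtTopUniformly_of_weightedBound hΛ0.le hd fun N hN => (main N hN).1
  obtain ⟨hv_decay, hv_deriv⟩ :=
    decaysAtTopUniformly_of_weightedBound hΛ0.le hd fun N hN => (main N hN).2.1
  obtain ⟨hw_decay, hw_deriv⟩ :=
    decaysAtTopUniformly_of_weightedBound hΛ0.le hd fun N hN => (main N hN).2.2
  exact ⟨hu_decay, hv_decay, hw_decay, hu_deriv, hv_deriv, hw_deriv⟩
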